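/- **Lemma 2.4.** All rings are associative, unital and non-zero, and all modules are unitary right modules. Let $A$ be a prime right Goldie ring: the product of any two non-zero ideals of $A$ is non-zero, $A_A$ contains no infinite direct sum of non-zero submodules, and $A$ satisfies the maximum condition on right annihilators of subsets of $A$. Conventions. A submodule is *essential* if it meets every non-zero submodule non-trivially. An element of $A$ is *regular* if its left and right annihilators are zero. A module $M$ is *non-singular* if $0$ is its only element $m$ whose annihilator $\{a\in A: ma=0\}$ is an essential right ideal. The *Goldie dimension* of $M$ is the supremum of the cardinalities of sets of non-zero submodules of $M$ whose sum is direct. For a cardinal $\tau$, a module is *$\tau$-generated* if it has a generating set of cardinality at most $\tau$. A module is a *max module* if each of its non-zero submodules has a maximal submodule; it is *seminoetherian* if all its factor modules are max modules. 1. Every non-zero (two-sided) ideal $B$ of $A$ is an essential right ideal and contains a regular element. 2. There exists a positive integer $n$ such that, for any non-zero elements $b_1,\dots,b_n$ of $A$, the external direct sum $b_1A\oplus\dots\oplus b_nA$ contains an isomorphic copy of the free cyclic module $A_A$. 3. Let $\tau$ be an infinite cardinal. If a right $A$-module $X$ contains a non-singular submodule $Y$ of Goldie dimension $\tau$, then $X$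 contains a non-zero free submodule $F$ of rank $\tau$ (that is, with a basis of cardinality $\tau$) such that every $\tau$-generated right $A$-module is a homomorphic image of $F$. 4. Let $\tau$ be an infinite cardinal. If there exists a non-singular seminoetherian right $A$-module of Goldie dimension $\tau$, then every $\tau$-generated right $A$-module is seminoetherian; in particular, every countably generated right $A$-module is seminoetherian. -/

import Mathlib

open scoped Cardinal

universe u v w

/-! Right modules over a ring `A` are modules over `Aᵐᵒᵖ`, with `m a = MulOpposite.op a • m`.
In particular `A` is a module over `Aᵐᵒᵖ` by right multiplication, and
`Submodule Aᵐᵒᵖ A` is the lattice of right ideals of `A`. -/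

section Modules

variable (R : Type*) [Ring R] (M : Type*) [AddCommGroup M] [Module R M]

/-- A submodule is essential if it meets every non-zero submodule non-trivially. -/
def IsEssentialSubmodule {R : Type*} [Ring R] {M : Type*} [AddCommGroup M] [Module R M]
    (X : Submodule R M) : Prop :=
  ∀ Y : Submodule R M, Y ≠ ⊥ → X ⊓ Y ≠ ⊥

/-- A set of non-zero submodules whose sum is direct. -/
def IsDirectFamily {R : Type*} [Ring R] {M : Type*} [AddCommGroup M] [Module R M]
    (S : Set (Submodule R M)) : Prop :=
  ⊥ ∉ S ∧ sSupIndep S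

/-- `M` is finite-dimensional in the sense of Goldie: it has no submodule that is an infinite
direct sum of non-zero modules. -/
def IsGoldieFiniteDimensional : Prop :=
  ∀ S : Set (Submodule R M), IsDirectFamily S → S.Finite

/-- The Goldie dimension of `M`: the supremum of the cardinalities of the sets of non-zero
submodules of `M` whose sum is direct. -/
noncomputable def goldieDim (R : Type*) [Ring R] (M : Type v) [AddCommGroup M] [Module R M] :
    Cardinal.{v} :=
  ⨆ S : {S : Set (Submodule R M) // IsDirectFamily S}, #S.1

/-- `M` is a max module if each of its non-zero submodules has a maximal submodule. -/
def IsMaxModule : Prop :=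
  ∀ N : Submodule R M, N ≠ ⊥ → ∃ P : Submodule R N, IsCoatom P

/-- `M` is seminoetherian if all its factor modules are max modules. -/
def IsSeminoetherian : Prop :=
  ∀ N : Submodule R M, IsMaxModule R (M ⧸ N)

/-- `M` is `τ`-generated: it has a generating set of cardinality at most `τ`. -/
def IsCardGenerated (R : Type*) [Ring R] (M : Type w) [AddCommGroup M] [Module R M]
    (τ : Cardinal.{v}) : Prop :=
  ∃ s : Set M, Cardinal.lift.{v} #s ≤ Cardinal.lift.{w} τ ∧ Submodule.span R s = ⊤

end Modules

section RightModules

open MulOpposite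

/-- The right annihilator `r(N) = {a ∈ A | x a = 0 for all x ∈ N}` of a subset `N` of a right
`A`-module, a right ideal of `A`. -/
def rightAnnihilator (A : Type*) [Ring A] {M : Type*} [AddCommGroup M] [Module Aᵐᵒᵖ M]
    (N : Set M) : Submodule Aᵐᵒᵖ A where
  carrier := {a | ∀ x ∈ N, op a • x = 0}
  add_mem' := by
    intro a b ha hb x hx
    rw [op_add, add_smul, ha x hx, hb x hx, add_zero]
  zero_mem' := by
    intro x _
    rw [op_zero, zero_smul]
  smul_mem' := by
    intro c a ha x hx
    have h : op (c • a) = c * op a := by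
      rw [← op_unop c, op_smul_eq_mul, op_mul]
    rw [h, mul_smul, ha x hx, smul_zero]

/-- The singular part of a right `A`-module: the set of the elements whose right annihilator is
an essential right ideal of `A`. -/
def singularPart (A : Type*) [Ring A] (M : Type*) [AddCommGroup M] [Module Aᵐᵒᵖ M] : Set M :=
  {m | IsEssentialSubmodule (rightAnnihilator A ({m} : Set M))}

/-- A right `A`-module is non-singular if its singular part is zero. -/
def IsNonsingularModule (A : Type*) [Ring A] (M : Type*) [AddCommGroup M] [Module Aᵐᵒᵖ M] :
    Prop :=
  singularPart A M = {0}

/-- A ring is prime if the product of any two non-zero two-sided ideals is non-zero. -/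
def IsPrimeRing (A : Type*) [Ring A] : Prop :=
  ∀ I J : Ideal A, I.IsTwoSided → J.IsTwoSided → I ≠ ⊥ → J ≠ ⊥ → I * J ≠ ⊥

/-- A right Goldie ring: a right finite-dimensional ring in which every non-empty set of right
annihilators of subsets of the ring has a maximal element. -/
def IsRightGoldie (A : Type*) [Ring A] : Prop :=
  IsGoldieFiniteDimensional Aᵐᵒᵖ A ∧
    ∀ 𝒮 : Set (Submodule Aᵐᵒᵖ A), 𝒮.Nonempty →
      (∀ I ∈ 𝒮, ∃ N : Set A, I = rightAnnihilator A N) → ∃ I, Maximal (· ∈ 𝒮) I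

/-- A two-sided ideal, regarded as a right ideal. -/
def Ideal.toRightIdeal {A : Type*} [Ring A] (B : Ideal A) [B.IsTwoSided] :
    Submodule Aᵐᵒᵖ A where
  carrier := B
  add_mem' := B.add_mem
  zero_mem' := B.zero_mem
  smul_mem' := by
    intro c a ha
    rw [← op_unop c, op_smul_eq_mul]
    exact B.mul_mem_right _ ha

/-- The principal right ideal `bA`. -/
def principalRightIdeal {A : Type*} [Ring A] (b : A) : Submodule Aᵐᵒᵖ A :=
  Submodule.span Aᵐᵒᵖ {b}

end RightModules

/-!
Two facts carry the argument.

The first is Goldie's theorem for a prime right Goldie ring `A`: every essential right ideal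
contains a regular element (`IsRightGoldie.exists_isRegular_mem`). It rests on the vanishing of the
singular ideal, on the existence of non-nilpotent elements in non-zero right ideals, and on
the well-foundedness of the relation `MissesPartOf`, which says that the Goldie dimension of `A` is
finite without introducing it as a number. Since a non-zero ideal is an essential right ideal by
primeness, it contains a regular element.

The second is that a suitable `n` makes any `n` non-zero principal right ideals `bᵢ A` contain
elements `bᵢ aᵢ` with zero common right annihilator
(`IsRightGoldie.exists_forall_exists_mul_eq_zero`). Then `x ↦ (bᵢ aᵢ x)ᵢ` embeds `A` into
`b₁A ⊕ ⋯ ⊕ bₙA`.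

In a non-singular module every non-zero submodule contains a copy of a non-zero right ideal, hence
a uniform submodule, so a maximal independent set of uniform submodules has essential sum. The
exchange property of uniform submodules (`exists_exchange`) shows that this set has the largest
possible cardinality (`goldieDim_eq_mk`); thus the supremum defining the Goldie dimension `τ` is
attained. Dividing the set into `τ` blocks of `n` submodules and applying the second fact to each
block gives a free submodule of rank `τ`. Every `τ`-generated module is an image of this submodule,
and images of submodules of a seminoetherian module are seminoetherian.
-/

/-! ### Independent families and uniform submodules -/

section General

variable {R : Type*} [Ring R] {M : Type*} [AddCommGroup M] [Module R M]

theorem exists_mem_inf_ne_zero {X Y : Submodule R M} (h : X ⊓ Y ≠ ⊥) :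
    ∃ x ∈ X, x ∈ Y ∧ x ≠ 0 := by
  obtain ⟨x, hx, hx0⟩ := Submodule.exists_mem_ne_zero_of_ne_bot h
  exact ⟨x, hx.1, hx.2, hx0⟩

theorem inf_ne_bot_of_mem {X Y : Submodule R M} {x : M} (hX : x ∈ X) (hY : x ∈ Y) (h0 : x ≠ 0) :
    X ⊓ Y ≠ ⊥ := fun h => h0 (by simpa [h] using (show x ∈ X ⊓ Y from ⟨hX, hY⟩))

theorem IsEssentialSubmodule.exists_smul_mem {X : Submodule R M} (hX : IsEssentialSubmodule X)
    {m : M} (hm : m ≠ 0) : ∃ r : R, r • m ∈ X ∧ r • m ≠ 0 := by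
  obtain ⟨y, hyX, hy, hy0⟩ := exists_mem_inf_ne_zero
    (hX (Submodule.span R {m}) (by simpa [Submodule.span_singleton_eq_bot] using hm))
  obtain ⟨r, rfl⟩ := Submodule.mem_span_singleton.1 hy
  exact ⟨r, hyX, hy0⟩

theorem IsEssentialSubmodule.of_forall_exists_smul_mem {X : Submodule R M}
    (h : ∀ m : M, m ≠ 0 → ∃ r : R, r • m ∈ X ∧ r • m ≠ 0) : IsEssentialSubmodule X := by
  intro Y hY
  obtain ⟨y, hy, hy0⟩ := Submodule.exists_mem_ne_zero_of_ne_bot hY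
  obtain ⟨r, hr, hr0⟩ := h y hy0
  exact inf_ne_bot_of_mem hr (Y.smul_mem r hy) hr0

theorem IsEssentialSubmodule.mono {X X' : Submodule R M} (hX : IsEssentialSubmodule X)
    (h : X ≤ X') : IsEssentialSubmodule X' :=
  fun Y hY h0 => hX Y hY (le_bot_iff.1 (h0 ▸ inf_le_inf_right Y h))

/-- A family of submodules is independent as soon as one of its members is disjoint from the sum
of the others and those others are independent. -/
theorem iSupIndep_of_disjoint_of_compl {ι : Type*} {W : ι → Submodule R M} (i₀ : ι)
    (hd : Disjoint (W i₀) (⨆ (j) (_ : j ≠ i₀), W j))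
    (hi : iSupIndep fun j : {j // j ≠ i₀} => W j) : iSupIndep W := by
  classical
  rw [iSupIndep_iff_finsetSum_eq_zero_imp_eq_zero] at hi ⊢
  have key : ∀ (s : Finset ι) (v : ι → M), i₀ ∉ s → (∀ i ∈ s, v i ∈ W i) → ∑ i ∈ s, v i = 0 →
      ∀ i ∈ s, v i = 0 := by
    intro s v hs hv h0 i his
    have hne : ∀ j ∈ s, j ≠ i₀ := fun j hj h => hs (h ▸ hj)
    refine hi (s.subtype (· ≠ i₀)) (fun j => v j) (fun j hj => hv j (by simpa using hj)) ?_
      ⟨i, hne i his⟩ (by simpa using his)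
    rw [Finset.sum_subtype_of_mem v hne, h0]
  intro s v hv h0
  by_cases hs : i₀ ∈ s
  · rw [← Finset.add_sum_erase s v hs] at h0
    have hz : v i₀ = 0 := by
      refine Submodule.disjoint_def.1 hd _ (hv i₀ hs) ?_
      rw [eq_neg_of_add_eq_zero_left h0]
      refine neg_mem (Submodule.sum_mem _ fun j hj => ?_)
      exact Submodule.mem_iSup_of_mem j (Submodule.mem_iSup_of_mem (Finset.ne_of_mem_erase hj)
        (hv j (Finset.mem_of_mem_erase hj)))
    rw [hz, zero_add] at h0
    intro i his
    by_cases hi' : i = i₀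
    · rw [hi', hz]
    · exact key _ v (Finset.notMem_erase i₀ s) (fun j hj => hv j (Finset.mem_of_mem_erase hj)) h0 i
        (Finset.mem_erase.2 ⟨hi', his⟩)
  · exact key s v hs hv h0

/-- A submodule is uniform if it is non-zero and any two of its non-zero submodules meet
non-trivially. -/
def IsUniformSubmodule (U : Submodule R M) : Prop :=
  U ≠ ⊥ ∧ ∀ V W : Submodule R M, V ≤ U → W ≤ U → V ≠ ⊥ → W ≠ ⊥ → V ⊓ W ≠ ⊥

theorem IsUniformSubmodule.exists_smul_mem {U W : Submodule R M} (hU : IsUniformSubmodule U)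
    (hW : U ⊓ W ≠ ⊥) {u : M} (hu : u ∈ U) (hu0 : u ≠ 0) : ∃ r : R, r • u ∈ W ∧ r • u ≠ 0 := by
  obtain ⟨y, hy, hyW, hy0⟩ := exists_mem_inf_ne_zero (hU.2 (Submodule.span R {u}) (U ⊓ W)
    (by simpa using hu) inf_le_left (by simpa [Submodule.span_singleton_eq_bot] using hu0) hW)
  obtain ⟨r, rfl⟩ := Submodule.mem_span_singleton.1 hy
  exact ⟨r, hyW.2, hy0⟩

theorem IsUniformSubmodule.map {M' : Type*} [AddCommGroup M'] [Module R M'] {U : Submodule R M}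
    (hU : IsUniformSubmodule U) (f : M →ₗ[R] M') (hf : ∀ x ∈ U, f x = 0 → x = 0) :
    IsUniformSubmodule (U.map f) := by
  have pull : ∀ V : Submodule R M', V ≤ U.map f → V ≠ ⊥ → U ⊓ V.comap f ≠ ⊥ := by
    intro V hV hV0
    obtain ⟨y, hy, hy0⟩ := Submodule.exists_mem_ne_zero_of_ne_bot hV0
    obtain ⟨x, hx, rfl⟩ := hV hy
    exact inf_ne_bot_of_mem hx hy (fun h => hy0 (by rw [h, map_zero]))
  refine ⟨fun h => hU.1 ?_, fun V W hV hW hV0 hW0 => ?_⟩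
  · refine (Submodule.eq_bot_iff _).2 fun x hx => hf x hx ?_
    simpa [h] using Submodule.mem_map_of_mem (f := f) hx
  · obtain ⟨x, hxV, hxW, hx0⟩ := exists_mem_inf_ne_zero
      (hU.2 _ _ inf_le_left inf_le_left (pull V hV hV0) (pull W hW hW0))
    exact inf_ne_bot_of_mem hxV.2 hxW.2 (fun h => hx0 (hf x hxV.1 h))

/-- A submodule that meets every member of an independent family of uniform submodules meets
every non-zero cyclic submodule of their sum. -/
theorem exists_smul_mem_of_mem_iSup {ι : Type*} {U : ι → Submodule R M}
    (hU : ∀ i, IsUniformSubmodule (U i)) (hind : iSupIndep U) {W : Submodule R M}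
    (hW : ∀ i, U i ⊓ W ≠ ⊥) {x : M} (hx : x ∈ ⨆ i, U i) (hx0 : x ≠ 0) :
    ∃ r : R, r • x ∈ W ∧ r • x ≠ 0 := by
  classical
  obtain ⟨s, hs⟩ := Submodule.mem_iSup_iff_exists_finset.1 hx
  clear hx
  induction s using Finset.induction_on generalizing x with
  | empty => simp at hs; exact absurd hs hx0
  | insert i s his ih =>
    rw [Finset.iSup_insert] at hs
    obtain ⟨u, hu, y, hy, rfl⟩ := Submodule.mem_sup.1 hs
    by_cases hy0 : y = 0
    · subst hy0
      rw [add_zero] at hx0 ⊢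
      exact (hU i).exists_smul_mem (hW i) hu hx0
    obtain ⟨r, hr, hr0⟩ := ih hy0 hy
    by_cases hru : r • u = 0
    · exact ⟨r, by simpa [smul_add, hru] using hr, by simpa [smul_add, hru] using hr0⟩
    obtain ⟨t, ht, ht0⟩ := (hU i).exists_smul_mem (hW i) ((U i).smul_mem r hu) hru
    refine ⟨t * r, ?_, fun h => ht0 ?_⟩
    · rw [smul_add, mul_smul, mul_smul]
      exact W.add_mem ht (W.smul_mem t hr)
    · rw [smul_add, mul_smul, mul_smul] at h
      refine Submodule.disjoint_def.1 (hind.disjoint_biSup (y := (s : Set ι)) (by simpa using his))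
        _ ((U i).smul_mem t ((U i).smul_mem r hu)) ?_
      rw [eq_neg_of_add_eq_zero_left h]
      exact neg_mem (Submodule.smul_mem _ t (Submodule.smul_mem _ r (by simpa using hy)))

/-! ### Invariance of the Goldie dimension -/

/-- The exchange property of uniform submodules: finitely many members of an independent family
of non-zero submodules of `⨆ i, U i` can be replaced by distinct members of `U`. -/
theorem exists_exchange {ι J : Type*} [DecidableEq J] {U : ι → Submodule R M}
    (hU : ∀ i, IsUniformSubmodule (U i)) (hind : iSupIndep U) {V : J → Submodule R M}
    (hV0 : ∀ j, V j ≠ ⊥) (hVind : iSupIndep V) (hVU : ∀ j, V j ≤ ⨆ i, U i) (S : Finset J) :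
    ∃ f : J → ι, Set.InjOn f S ∧ iSupIndep fun j => if j ∈ S then U (f j) else V j := by
  have hne : J → Nonempty ι := fun j => by
    by_contra h
    rw [not_nonempty_iff] at h
    exact hV0 j (le_bot_iff.1 (by simpa only [iSup_of_empty] using hVU j))
  induction S using Finset.induction_on with
  | empty =>
    exact ⟨fun j => (hne j).some, by simp, by simpa using hVind⟩
  | insert j S hj ih =>
    obtain ⟨f, hf, hW⟩ := ih
    set W : J → Submodule R M := fun j => if j ∈ S then U (f j) else V j with hWdef
    have hWj : W j = V j := by simp [hWdef, hj]
    obtain ⟨i, hi⟩ : ∃ i, U i ⊓ (⨆ (k) (_ : k ≠ j), W k) = ⊥ := by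
      by_contra! hcon
      obtain ⟨y, hy, hy0⟩ := Submodule.exists_mem_ne_zero_of_ne_bot (hV0 j)
      obtain ⟨r, hr, hr0⟩ := exists_smul_mem_of_mem_iSup hU hind hcon (hVU j hy) hy0
      exact hr0 (Submodule.disjoint_def.1 (hW j) _ (hWj ▸ (V j).smul_mem r hy) hr)
    refine ⟨Function.update f j i, ?_, ?_⟩
    · have hfi : ∀ k ∈ S, f k ≠ i := by
        rintro k hk rfl
        have hle : U (f k) ≤ ⨆ (k) (_ : k ≠ j), W k := by
          refine le_iSup₂_of_le k (ne_of_mem_of_not_mem hk hj) ?_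
          simp [hWdef, hk]
        rw [inf_eq_left.2 hle] at hi
        exact (hU _).1 hi
      have hupd : ∀ k ∈ S, Function.update f j i k = f k := fun k hk =>
        Function.update_of_ne (ne_of_mem_of_not_mem hk hj) _ _
      rw [Finset.coe_insert, Set.injOn_insert (by simpa using hj)]
      refine ⟨hf.congr fun k hk => (hupd k hk).symm, ?_⟩
      rintro ⟨k, hk, hki⟩
      rw [hupd k hk, Function.update_self] at hki
      exact hfi k hk hki
    · have heq : ∀ k, k ≠ j →
          (if k ∈ insert j S then U (Function.update f j i k) else V k) = W k := by
        intro k hk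
        simp [hWdef, Finset.mem_insert, hk]
      refine iSupIndep_of_disjoint_of_compl j ?_ ?_
      · have : (⨆ (k) (_ : k ≠ j), (if k ∈ insert j S then U (Function.update f j i k) else V k))
            = ⨆ (k) (_ : k ≠ j), W k := iSup_congr fun k => iSup_congr fun hk => heq k hk
        rw [this, disjoint_iff]
        simpa using hi
      · have : (fun k : {k // k ≠ j} =>
            if (k : J) ∈ insert j S then U (Function.update f j i k) else V k) =
            fun k : {k // k ≠ j} => W k := funext fun k => heq k k.2
        rw [this]
        exact hW.comp Subtype.val_injective

theorem card_le_card_of_le_iSup {ι J : Type*} [Fintype ι] {U : ι → Submodule R M}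
    (hU : ∀ i, IsUniformSubmodule (U i)) (hind : iSupIndep U) {V : J → Submodule R M}
    (hV0 : ∀ j, V j ≠ ⊥) (hVind : iSupIndep V) (hVU : ∀ j, V j ≤ ⨆ i, U i) (S : Finset J) :
    S.card ≤ Fintype.card ι := by
  classical
  obtain ⟨f, hf, -⟩ := exists_exchange hU hind hV0 hVind hVU S
  exact Finset.card_le_card_of_injOn f (fun _ _ => Finset.mem_univ _) hf

theorem finite_of_le_iSup {ι J : Type*} [Finite ι] {U : ι → Submodule R M}
    (hU : ∀ i, IsUniformSubmodule (U i)) (hind : iSupIndep U) {V : J → Submodule R M}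
    (hV0 : ∀ j, V j ≠ ⊥) (hVind : iSupIndep V) (hVU : ∀ j, V j ≤ ⨆ i, U i) : Finite J := by
  have := Fintype.ofFinite ι
  by_contra h
  rw [not_finite_iff_infinite] at h
  obtain ⟨S, hS⟩ := Infinite.exists_subset_card_eq J (Fintype.card ι + 1)
  have := card_le_card_of_le_iSup hU hind hV0 hVind hVU S
  omega

/-- No independent family of non-zero submodules is larger than an independent family of uniform
submodules with essential sum. -/
theorem mk_le_mk_of_isEssentialSubmodule_iSup {ι J : Type v} {U : ι → Submodule R M}
    (hU : ∀ i, IsUniformSubmodule (U i)) (hind : iSupIndep U)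
    (hess : IsEssentialSubmodule (⨆ i, U i)) {V : J → Submodule R M}
    (hV0 : ∀ j, V j ≠ ⊥) (hVind : iSupIndep V) : #J ≤ #ι := by
  classical
  -- Shrinking the `V j` to submodules of `⨆ i, U i` keeps them non-zero and independent.
  have hV0' : ∀ j, (⨆ i, U i) ⊓ V j ≠ ⊥ := fun j => hess _ (hV0 j)
  have hVind' : iSupIndep fun j => (⨆ i, U i) ⊓ V j := hVind.mono fun j => inf_le_right
  rcases finite_or_infinite ι with hfin | hinf
  · have := Fintype.ofFinite ι
    have hJ := finite_of_le_iSup hU hind hV0' hVind' fun j => inf_le_left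
    have := Fintype.ofFinite J
    rw [Cardinal.mk_fintype, Cardinal.mk_fintype]
    exact_mod_cast card_le_card_of_le_iSup hU hind hV0' hVind' (fun j => inf_le_left) Finset.univ
  -- Each `V j` meets some finite partial sum, and each finite partial sum serves finitely many `j`.
  have hF : ∀ j, ∃ F : Finset ι, (⨆ i ∈ F, U i) ⊓ V j ≠ ⊥ := by
    intro j
    obtain ⟨x, hx, hxV, hx0⟩ := exists_mem_inf_ne_zero (hV0' j)
    obtain ⟨F, hF⟩ := Submodule.mem_iSup_iff_exists_finset.1 hx
    exact ⟨F, inf_ne_bot_of_mem hF hxV hx0⟩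
  choose g hg using hF
  have hfib : ∀ F : Finset ι, #(g ⁻¹' {F}) ≤ ℵ₀ := by
    intro F
    have : Finite (g ⁻¹' {F}) := by
      refine finite_of_le_iSup (U := fun i : F => U i) (fun i => hU i)
        (hind.comp Subtype.val_injective)
        (V := fun j : g ⁻¹' {F} => (⨆ i ∈ F, U i) ⊓ V j) (fun j => ?_)
        ((hVind.comp Subtype.val_injective).mono fun j => inf_le_right) (fun j => ?_)
      · have h := hg j
        rwa [show g j = F from j.2] at h
      · exact inf_le_left.trans (by rw [iSup_subtype])
    exact Cardinal.mk_le_aleph0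
  refine (Cardinal.mk_le_mk_mul_of_mk_preimage_le g hfib).trans ?_
  rw [Cardinal.mk_finset_of_infinite]
  exact (Cardinal.mul_eq_left (Cardinal.aleph0_le_mk ι) (Cardinal.aleph0_le_mk ι)
    Cardinal.aleph0_ne_zero).le

theorem goldieDim_eq_mk {M : Type v} [AddCommGroup M] [Module R M] {S : Set (Submodule R M)}
    (hU : ∀ U ∈ S, IsUniformSubmodule U) (hind : sSupIndep S)
    (hess : IsEssentialSubmodule (sSup S)) : goldieDim R M = #S := by
  have hbot : ⊥ ∉ S := fun h => (hU _ h).1 rfl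
  refine le_antisymm (ciSup_le' fun T => ?_) ?_
  · have hT := T.2
    refine mk_le_mk_of_isEssentialSubmodule_iSup (U := fun i : S => (i : Submodule R M))
      (fun i => hU i i.2) (by rwa [← sSupIndep_iff]) (by rwa [← sSup_eq_iSup'])
      (V := fun j : T.1 => (j : Submodule R M)) (fun j h => hT.1 (h ▸ j.2)) ?_
    rw [← sSupIndep_iff]
    exact hT.2
  · exact le_ciSup (f := fun T : {S : Set (Submodule R M) // IsDirectFamily S} => #T.1)
      Cardinal.bddAbove_of_small ⟨S, hbot, hind⟩

/-- If every non-zero submodule contains a uniform submodule, then a maximal independent set of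
uniform submodules has essential sum. -/
theorem exists_sSupIndep_isUniformSubmodule
    (h : ∀ N : Submodule R M, N ≠ ⊥ → ∃ U ≤ N, IsUniformSubmodule U) :
    ∃ S : Set (Submodule R M), (∀ U ∈ S, IsUniformSubmodule U) ∧ sSupIndep S ∧
      IsEssentialSubmodule (sSup S) := by
  obtain ⟨S, hS⟩ := zorn_subset
    {S : Set (Submodule R M) | (∀ U ∈ S, IsUniformSubmodule U) ∧ sSupIndep S} (by
      intro c hc hchain
      refine ⟨⋃₀ c, ⟨?_, iSupIndep_sUnion_of_directed hchain.directedOn fun s hs => (hc hs).2⟩,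
        fun s hs => Set.subset_sUnion_of_mem hs⟩
      rintro U ⟨s, hs, hUs⟩
      exact (hc hs).1 U hUs)
  refine ⟨S, hS.prop.1, hS.prop.2, fun N hN hbot => ?_⟩
  obtain ⟨U, hUN, hU⟩ := h N hN
  have hd : Disjoint U (sSup S) :=
    disjoint_iff.2 (le_bot_iff.1 (by rw [← hbot, inf_comm]; exact inf_le_inf_left _ hUN))
  have hUS : U ∉ S := fun hmem => hU.1 (disjoint_self.1 (hd.mono_right (le_sSup hmem)))
  have hins : insert U S ∈
      {S : Set (Submodule R M) | (∀ U ∈ S, IsUniformSubmodule U) ∧ sSupIndep S} := by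
    refine ⟨?_, ?_⟩
    · rintro V (rfl | hV)
      exacts [hU, hS.prop.1 V hV]
    · rw [sSupIndep_iff]
      have hmem : ∀ j : {j : ↥(insert U S) // j ≠ ⟨U, Set.mem_insert U S⟩},
          (j.1 : Submodule R M) ∈ S := fun j =>
        j.1.2.resolve_left fun h => j.2 (Subtype.ext h)
      refine iSupIndep_of_disjoint_of_compl ⟨U, Set.mem_insert U S⟩ ?_ ?_
      · exact hd.mono_right (iSup₂_le fun j hj => le_sSup (hmem ⟨j, hj⟩))
      · refine ((sSupIndep_iff S).1 hS.prop.2).comp (f := fun j => ⟨j.1, hmem j⟩) ?_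
        intro j k hjk
        exact Subtype.ext (Subtype.ext (by simpa using hjk))
  exact hUS (hS.le_of_ge hins (Set.subset_insert U S) (Set.mem_insert U S))

/-! ### Finite Goldie dimension -/

/-- `P` is smaller than `Q` if it is contained in `Q` and misses some non-zero submodule of `Q`,
so that the Goldie dimension of `P` is less than that of `Q` if the latter is finite. -/
def MissesPartOf (P Q : Submodule R M) : Prop :=
  P ≤ Q ∧ ∃ V ≤ Q, V ≠ ⊥ ∧ Disjoint V P

/-- In a descending chain, submodules of successive members that miss the next member are
independent. -/
theorem iSupIndep_of_antitone {P V : ℕ → Submodule R M} (hP : Antitone P) (hV : ∀ n, V n ≤ P n)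
    (hd : ∀ n, Disjoint (V n) (P (n + 1))) : iSupIndep V := by
  classical
  rw [iSupIndep_iff_finsetSum_eq_zero_imp_eq_zero]
  intro s v hv h0
  by_contra! hcon
  have hne : (s.filter fun i => v i ≠ 0).Nonempty :=
    let ⟨i, hi, hi0⟩ := hcon; ⟨i, Finset.mem_filter.2 ⟨hi, hi0⟩⟩
  set i := (s.filter fun i => v i ≠ 0).min' hne with hidef
  obtain ⟨his, hi0⟩ := Finset.mem_filter.1 ((s.filter fun i => v i ≠ 0).min'_mem hne)
  rw [← hidef] at his hi0
  rw [← Finset.add_sum_erase s v his] at h0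
  refine hi0 (Submodule.disjoint_def.1 (hd i) _ (hv i his) ?_)
  rw [eq_neg_of_add_eq_zero_left h0]
  refine neg_mem (Submodule.sum_mem _ fun j hj => ?_)
  have hjs := Finset.mem_of_mem_erase hj
  by_cases hj0 : v j = 0
  · rw [hj0]; exact zero_mem _
  have hij : i ≤ j := Finset.min'_le _ _ (Finset.mem_filter.2 ⟨hjs, hj0⟩)
  have hij' : i + 1 ≤ j := lt_of_le_of_ne hij (Finset.ne_of_mem_erase hj).symm
  exact hP hij' (hV j (hv j hjs))

theorem IsGoldieFiniteDimensional.not_iSupIndep (h : IsGoldieFiniteDimensional R M)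
    {V : ℕ → Submodule R M} (hV0 : ∀ n, V n ≠ ⊥) : ¬ iSupIndep V := fun hV =>
  Set.infinite_range_of_injective (hV.injective hV0)
    (h _ ⟨fun ⟨n, hn⟩ => hV0 n hn, hV.sSupIndep_range⟩)

theorem IsGoldieFiniteDimensional.wellFounded_missesPartOf (h : IsGoldieFiniteDimensional R M) :
    WellFounded (MissesPartOf : Submodule R M → Submodule R M → Prop) := by
  rw [wellFounded_iff_isEmpty_descending_chain]
  refine ⟨fun ⟨P, hP⟩ => ?_⟩
  choose V hV hV0 hd using fun n => (hP n).2
  exact h.not_iSupIndep hV0 (iSupIndep_of_antitone (antitone_nat_of_succ_le fun n => (hP n).1) hV hd)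

theorem IsGoldieFiniteDimensional.exists_isUniformSubmodule_le
    (h : IsGoldieFiniteDimensional R M) {N : Submodule R M} (hN : N ≠ ⊥) :
    ∃ U ≤ N, IsUniformSubmodule U := by
  obtain ⟨U, ⟨hU0, hUN⟩, hmin⟩ := h.wellFounded_missesPartOf.has_min {P | P ≠ ⊥ ∧ P ≤ N}
    ⟨N, hN, le_rfl⟩
  refine ⟨U, hUN, hU0, fun V W hV hW hV0 hW0 hVW => ?_⟩
  exact hmin W ⟨hW0, hW.trans hUN⟩ ⟨hW, V, hV, hV0, disjoint_iff.2 hVW⟩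

/-- An injective endomorphism of a module of finite Goldie dimension has essential range: if `V`
missed the range of `f`, then `V, f V, f² V, …` would be independent. -/
theorem IsGoldieFiniteDimensional.isEssentialSubmodule_range (h : IsGoldieFiniteDimensional R M)
    {f : M →ₗ[R] M} (hf : Function.Injective f) : IsEssentialSubmodule (LinearMap.range f) := by
  intro V hV hbot
  have hinj : ∀ n : ℕ, Function.Injective (f ^ n) := fun n => by
    rw [Module.End.coe_pow]; exact hf.iterate n
  refine h.not_iSupIndep (V := fun n => V.map (f ^ n)) (fun n h0 => hV ?_)
    (iSupIndep_of_antitone (P := fun n => LinearMap.range (f ^ n)) ?_ ?_ ?_)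
  · exact Submodule.map_injective_of_injective (hinj n) (by simpa using h0)
  · refine antitone_nat_of_succ_le fun n => ?_
    rw [pow_succ]
    exact LinearMap.range_comp_le_range _ _
  · exact fun n => LinearMap.map_le_range
  · intro n
    rw [Submodule.disjoint_def]
    rintro _ ⟨y, hy, rfl⟩ ⟨z, hz⟩
    rw [pow_succ, Module.End.mul_apply] at hz
    have hyz := hinj n hz
    rw [(Submodule.eq_bot_iff _).1 hbot y ⟨⟨z, hyz⟩, hy⟩, map_zero]

/-! ### Max modules and seminoetherian modules -/

theorem IsMaxModule.of_injective {M' : Type*} [AddCommGroup M'] [Module R M']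
    (h : IsMaxModule R M') (f : M →ₗ[R] M') (hf : Function.Injective f) : IsMaxModule R M := by
  intro N hN
  obtain ⟨P, hP⟩ := h (N.map f) (fun h0 => hN
    (Submodule.map_injective_of_injective hf (by simpa using h0)))
  exact ⟨_, ((Submodule.orderIsoMapComap (Submodule.equivMapOfInjective f hf N)).symm.isCoatom_iff
    P).2 hP⟩

/-- Homomorphic images of submodules of a seminoetherian module are seminoetherian. -/
theorem IsSeminoetherian.of_surjective {M' : Type*} [AddCommGroup M'] [Module R M']
    (h : IsSeminoetherian R M) (F : Submodule R M) (f : F →ₗ[R] M')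
    (hf : Function.Surjective f) : IsSeminoetherian R M' := by
  intro N
  set g : F →ₗ[R] M' ⧸ N := N.mkQ ∘ₗ f with hg
  have hgs : Function.Surjective g := N.mkQ_surjective.comp hf
  set K : Submodule R M := (LinearMap.ker g).map F.subtype with hK
  have hker : LinearMap.ker (K.mkQ ∘ₗ F.subtype) = LinearMap.ker g := by
    rw [LinearMap.ker_comp, Submodule.ker_mkQ, hK,
      Submodule.comap_map_eq_of_injective F.injective_subtype]
  refine (h K).of_injective
    ((LinearMap.ker g).liftQ (K.mkQ ∘ₗ F.subtype) hker.ge ∘ₗ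
      (g.quotKerEquivOfSurjective hgs).symm.toLinearMap) ?_
  have hinj : Function.Injective ((LinearMap.ker g).liftQ (K.mkQ ∘ₗ F.subtype) hker.ge) := by
    rw [← LinearMap.ker_eq_bot, Submodule.ker_liftQ_eq_bot' _ _ hker.symm]
  exact hinj.comp (g.quotKerEquivOfSurjective hgs).symm.injective

/-- A free module of rank `τ` maps onto every `τ`-generated module. -/
theorem Module.Basis.exists_surjective_of_isCardGenerated {K : Type v} {F : Type*}
    [AddCommGroup F] [Module R F] (b : Module.Basis K R F) {N : Type w} [AddCommGroup N]
    [Module R N] (hN : IsCardGenerated R N #K) : ∃ f : F →ₗ[R] N, Function.Surjective f := by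
  obtain ⟨s, hs, hspan⟩ := hN
  obtain ⟨e⟩ := Cardinal.lift_mk_le'.1 hs
  refine ⟨b.constr ℕ (Function.extend e Subtype.val 0), ?_⟩
  rw [← LinearMap.range_eq_top, eq_top_iff, ← hspan, Submodule.span_le]
  intro x hx
  refine ⟨b (e ⟨x, hx⟩), ?_⟩
  rw [Module.Basis.constr_basis, e.injective.extend_apply]

end General

/-! ### Goldie's theorem for prime rings -/

section Goldie

open MulOpposite

variable {A : Type*} [Ring A]

theorem mem_rightAnnihilator_singleton {M : Type*} [AddCommGroup M] [Module Aᵐᵒᵖ M] {m : M}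
    {a : A} : a ∈ rightAnnihilator A ({m} : Set M) ↔ op a • m = 0 :=
  ⟨fun h => h m rfl, by rintro h _ rfl; exact h⟩

theorem mem_rightAnnihilator_singleton_self {b a : A} :
    a ∈ rightAnnihilator A ({b} : Set A) ↔ b * a = 0 := by
  rw [mem_rightAnnihilator_singleton, op_smul_eq_mul]

variable (A) in
/-- The homomorphism `a ↦ x a` of right modules from `A` to `M`. For `M = A` it is left
multiplication by `x`. -/
def orbitMap {M : Type*} [AddCommGroup M] [Module Aᵐᵒᵖ M] (x : M) : A →ₗ[Aᵐᵒᵖ] M where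
  toFun a := op a • x
  map_add' a b := by rw [op_add, add_smul]
  map_smul' c a := by
    rw [← op_unop c, op_smul_eq_mul, op_mul, mul_smul, RingHom.id_apply]

theorem orbitMap_apply_self (x a : A) : orbitMap A x a = x * a := rfl

theorem IsPrimeRing.eq_zero_or_eq_zero (hA : IsPrimeRing A) {a b : A}
    (h : ∀ r, a * r * b = 0) : a = 0 ∨ b = 0 := by
  by_contra! hab
  -- `I` is the left annihilator of `A b`, and `J` the right annihilator of `I A`.
  let I : Ideal A :=
    { carrier := {x | ∀ r, x * r * b = 0}
      add_mem' := fun hx hy r => by rw [add_mul, add_mul, hx r, hy r, add_zero]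
      zero_mem' := fun r => by rw [zero_mul, zero_mul]
      smul_mem' := fun c x hx r => by rw [smul_eq_mul, mul_assoc c, mul_assoc c, hx r, mul_zero] }
  let J : Ideal A :=
    { carrier := {y | ∀ x ∈ I, ∀ r, x * r * y = 0}
      add_mem' := fun hx hy z hz r => by rw [mul_add, hx z hz r, hy z hz r, add_zero]
      zero_mem' := fun x _ r => mul_zero _
      smul_mem' := fun c y hy x hx r => by
        rw [smul_eq_mul, ← mul_assoc, mul_assoc x]; exact hy x hx _ }
  have hI : I.IsTwoSided := ⟨fun {x} c hx r => by rw [mul_assoc x]; exact hx _⟩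
  have hJ : J.IsTwoSided := ⟨fun {y} c hy x hx r => by rw [← mul_assoc, hy x hx r, zero_mul]⟩
  have haI : a ∈ I := h
  have hbJ : b ∈ J := fun x hx r => hx r
  refine hA I J hI hJ (fun h0 => hab.1 (by simpa [h0] using haI))
    (fun h0 => hab.2 (by simpa [h0] using hbJ)) ?_
  rw [eq_bot_iff, Ideal.mul_le]
  intro x hx y hy
  simpa using hy x hx 1

/-- Every non-empty set of elements of `A` has a member whose right annihilator is maximal among
those of the members of the set. -/
theorem IsRightGoldie.exists_maximal_rightAnnihilator (hA : IsRightGoldie A) {s : Set A}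
    (hs : s.Nonempty) : ∃ c ∈ s, ∀ d ∈ s, (∀ a, c * a = 0 → d * a = 0) →
      ∀ a, d * a = 0 → c * a = 0 := by
  obtain ⟨I, hI⟩ := hA.2 ((fun c : A => rightAnnihilator A ({c} : Set A)) '' s) (hs.image _)
    (by rintro _ ⟨c, -, rfl⟩; exact ⟨{c}, rfl⟩)
  obtain ⟨c, hc, rfl⟩ := hI.prop
  refine ⟨c, hc, fun d hd hcd a ha => ?_⟩
  refine mem_rightAnnihilator_singleton_self.1 (hI.le_of_ge ⟨d, hd, rfl⟩ (fun x hx => ?_)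
    (mem_rightAnnihilator_singleton_self.2 ha))
  exact mem_rightAnnihilator_singleton_self.2 (hcd x (mem_rightAnnihilator_singleton_self.1 hx))

/-- A prime right Goldie ring is right non-singular: if `a` is a non-zero element of the singular
ideal with maximal right annihilator, then `b a = 0` for every `b` in the singular ideal, so that
`a A a = 0`. -/
theorem IsRightGoldie.eq_zero_of_isEssentialSubmodule_rightAnnihilator (hA : IsRightGoldie A)
    (hp : IsPrimeRing A) {x : A} (hx : IsEssentialSubmodule (rightAnnihilator A ({x} : Set A))) :
    x = 0 := by
  by_contra hx0
  obtain ⟨a, ⟨ha0, ha⟩, hmax⟩ := hA.exists_maximal_rightAnnihilator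
    (s := {a | a ≠ 0 ∧ IsEssentialSubmodule (rightAnnihilator A ({a} : Set A))}) ⟨x, hx0, hx⟩
  refine ha0 ((or_self_iff).1 (hp.eq_zero_or_eq_zero fun r => ?_))
  have har : IsEssentialSubmodule (rightAnnihilator A ({a * r} : Set A)) := by
    refine .of_forall_exists_smul_mem fun m hm => ?_
    by_cases hrm : r * m = 0
    · refine ⟨1, ?_, by simpa using hm⟩
      rw [one_smul, mem_rightAnnihilator_singleton_self, mul_assoc, hrm, mul_zero]
    obtain ⟨t, ht, ht0⟩ := ha.exists_smul_mem hrm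
    rw [← op_unop t, op_smul_eq_mul, mem_rightAnnihilator_singleton_self] at ht
    rw [← op_unop t, op_smul_eq_mul] at ht0
    refine ⟨t, ?_, fun h => ht0 ?_⟩
    · rw [← op_unop t, op_smul_eq_mul, mem_rightAnnihilator_singleton_self, ← ht]
      noncomm_ring
    · rw [← op_unop t, op_smul_eq_mul] at h
      rw [mul_assoc, h, mul_zero]
  by_contra h0
  obtain ⟨t, ht, ht0⟩ := har.exists_smul_mem ha0
  rw [← op_unop t, op_smul_eq_mul] at ht ht0
  rw [mem_rightAnnihilator_singleton_self, ← mul_assoc] at ht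
  have hle : ∀ z, a * z = 0 → a * r * a * z = 0 := fun z hz => by rw [mul_assoc, hz, mul_zero]
  refine ht0 (hmax (a * r * a) ⟨h0, ha.mono fun z hz => ?_⟩ hle _ ht)
  exact mem_rightAnnihilator_singleton_self.2 (hle z (mem_rightAnnihilator_singleton_self.1 hz))

/-- Levitzki: a non-zero right ideal of a prime right Goldie ring is not nil. -/
theorem IsRightGoldie.exists_not_isNilpotent_mem (hA : IsRightGoldie A) (hp : IsPrimeRing A)
    {V : Submodule Aᵐᵒᵖ A} (hV : V ≠ ⊥) : ∃ z ∈ V, ¬ IsNilpotent z := by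
  by_contra! hnil
  obtain ⟨v, hv, hv0⟩ := Submodule.exists_mem_ne_zero_of_ne_bot hV
  -- The left ideal `A v` is nil, because `v A` is.
  have hleft : ∀ x : A, IsNilpotent (x * v) := by
    intro x
    obtain ⟨n, hn⟩ := hnil (v * x) (by simpa using V.smul_mem (op x) hv)
    have hcomm : ∀ k : ℕ, (x * v) ^ k * x = x * (v * x) ^ k := by
      intro k
      induction k with
      | zero => simp
      | succ k ih => rw [pow_succ', pow_succ', mul_assoc (x * v), ih]; noncomm_ring
    refine ⟨n + 1, ?_⟩
    rw [pow_succ, ← mul_assoc, hcomm, hn, mul_zero, zero_mul]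
  obtain ⟨c, ⟨hc0, y, rfl⟩, hmax⟩ := hA.exists_maximal_rightAnnihilator
    (s := {c | c ≠ 0 ∧ ∃ y, c = y * v}) ⟨v, hv0, 1, (one_mul v).symm⟩
  refine hc0 ((or_self_iff).1 (hp.eq_zero_or_eq_zero fun x => ?_))
  set d := x * (y * v) with hd
  rw [mul_assoc, ← hd]
  by_cases hd0 : d = 0
  · rw [hd0, mul_zero]
  classical
  have hdnil : ∃ n, d ^ n = 0 := by
    have := hleft (x * y)
    rwa [mul_assoc, ← hd] at this
  obtain ⟨k, hk⟩ : ∃ k, Nat.find hdnil = k + 2 := by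
    refine Nat.exists_eq_add_of_le' ?_
    by_contra hlt
    have hd1 : d ^ 1 = 0 := pow_eq_zero_of_le (by omega) (Nat.find_spec hdnil)
    exact hd0 (by simpa using hd1)
  -- `d ^ (k + 1)` is the last non-zero power of `d`, so it lies in `A v` and annihilates `d`.
  refine hmax (d ^ (k + 1)) ⟨Nat.find_min hdnil (by omega), d ^ k * x * y, ?_⟩ (fun z hz => ?_) d ?_
  · rw [pow_succ]
    nth_rw 2 [hd]
    noncomm_ring
  · rw [pow_succ, mul_assoc]
    nth_rw 2 [hd]
    rw [mul_assoc x, hz, mul_zero, mul_zero]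
  · rw [← pow_succ, ← hk]
    exact Nat.find_spec hdnil

/-- The element is a power of a non-nilpotent element of `V`, for which the right annihilators of
the powers have become stationary. -/
theorem IsRightGoldie.exists_mem_mul_self (hA : IsRightGoldie A) (hp : IsPrimeRing A)
    {V : Submodule Aᵐᵒᵖ A} (hV : V ≠ ⊥) :
    ∃ a ∈ V, a ≠ 0 ∧ ∀ y, a * a * y = 0 → a * y = 0 := by
  obtain ⟨z, hz, hnil⟩ := hA.exists_not_isNilpotent_mem hp hV
  have hz0 : ∀ n, z ^ n ≠ 0 := fun n hn => hnil ⟨n, hn⟩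
  obtain ⟨_, ⟨n, rfl⟩, hmax⟩ := hA.exists_maximal_rightAnnihilator
    (Set.range_nonempty fun n : ℕ => z ^ (n + 1))
  refine ⟨z ^ (n + 1), ?_, hz0 _, hmax _ ⟨n + (n + 1), ?_⟩ fun y hy => ?_⟩
  · rw [pow_succ']
    simpa using V.smul_mem (op (z ^ n)) hz
  · have hn : n + (n + 1) + 1 = (n + 1) + (n + 1) := by omega
    simp only [hn, pow_add]
  · rw [mul_assoc, hy, mul_zero]

/-- Goldie: every essential right ideal of a prime right Goldie ring contains a regular element.
The element is an element `c` of `E` with `r(c²) = r(c)` and with `r(c)` as small as possible: if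
`a ∈ E ∩ r(c)` is non-zero with `r(a²) = r(a)`, then `c + a` has the smaller right annihilator
`r(c) ∩ r(a)`. -/
theorem IsRightGoldie.exists_isRegular_mem (hA : IsRightGoldie A) (hp : IsPrimeRing A)
    {E : Submodule Aᵐᵒᵖ A} (hE : IsEssentialSubmodule E) : ∃ c ∈ E, IsRegular c := by
  obtain ⟨_, ⟨c, ⟨hcE, hcc⟩, rfl⟩, hmin⟩ := hA.1.wellFounded_missesPartOf.has_min
    ((fun c : A => rightAnnihilator A ({c} : Set A)) '' {c | c ∈ E ∧ ∀ y, c * c * y = 0 → c * y = 0})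
    ⟨_, 0, ⟨zero_mem _, fun y _ => zero_mul y⟩, rfl⟩
  have hbot : rightAnnihilator A ({c} : Set A) = ⊥ := by
    by_contra hne
    obtain ⟨a, ha, ha0, haa⟩ := hA.exists_mem_mul_self hp (hE _ hne)
    have hca : c * a = 0 := mem_rightAnnihilator_singleton_self.1 ha.2
    have hsum : ∀ y, (c + a) * y = 0 → c * y = 0 ∧ a * y = 0 := by
      intro y hy
      have h1 : c * y = 0 := hcc y <| by
        have : c * ((c + a) * y) = c * c * y + c * a * y := by noncomm_ring
        rwa [hy, hca, zero_mul, mul_zero, add_zero, eq_comm] at this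
      exact ⟨h1, by rwa [add_mul, h1, zero_add] at hy⟩
    refine hmin _ ⟨c + a, ⟨E.add_mem hcE ha.1, fun y hy => ?_⟩, rfl⟩
      ⟨fun y hy => ?_, Submodule.span Aᵐᵒᵖ {a}, ?_, ?_, ?_⟩
    · rw [mul_assoc] at hy
      obtain ⟨h1, h2⟩ := hsum _ hy
      have h3 : c * y = 0 := hcc y <| by
        have : c * ((c + a) * y) = c * c * y + c * a * y := by noncomm_ring
        rwa [h1, hca, zero_mul, add_zero, eq_comm] at this
      rw [add_mul, h3, zero_add] at h2 ⊢
      exact haa y (by rwa [mul_assoc])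
    · exact mem_rightAnnihilator_singleton_self.2
        (hsum y (mem_rightAnnihilator_singleton_self.1 hy)).1
    · rw [Submodule.span_singleton_le_iff_mem]
      exact ha.2
    · rwa [Ne, Submodule.span_singleton_eq_bot]
    · rw [Submodule.disjoint_def]
      intro x hx hxr
      obtain ⟨t, rfl⟩ := Submodule.mem_span_singleton.1 hx
      rw [← op_unop t, op_smul_eq_mul] at hxr ⊢
      have h2 := (hsum _ (mem_rightAnnihilator_singleton_self.1 hxr)).2
      exact haa _ (by rwa [mul_assoc])
  have hinj : ∀ x, c * x = 0 → x = 0 := fun x hx =>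
    (Submodule.eq_bot_iff _).1 hbot x (mem_rightAnnihilator_singleton_self.2 hx)
  refine ⟨c, hcE, isLeftRegular_iff_right_eq_zero_of_mul.2 hinj,
    isRightRegular_iff_left_eq_zero_of_mul.2 fun x hx => ?_⟩
  -- The right ideal `c A` is essential and is contained in `r(x)`.
  refine hA.eq_zero_of_isEssentialSubmodule_rightAnnihilator hp
    ((hA.1.isEssentialSubmodule_range (f := orbitMap A c)
      ((injective_iff_map_eq_zero _).2 hinj)).mono ?_)
  rintro _ ⟨y, rfl⟩
  rw [mem_rightAnnihilator_singleton_self, orbitMap_apply_self, ← mul_assoc, hx, zero_mul]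

theorem IsPrimeRing.isEssentialSubmodule_toRightIdeal (hp : IsPrimeRing A) (B : Ideal A)
    [B.IsTwoSided] (hB : B ≠ ⊥) : IsEssentialSubmodule B.toRightIdeal := by
  obtain ⟨b, hb, hb0⟩ := Submodule.exists_mem_ne_zero_of_ne_bot hB
  refine .of_forall_exists_smul_mem fun m hm => ?_
  obtain ⟨r, hr⟩ : ∃ r, m * r * b ≠ 0 := by
    by_contra! h
    exact (hp.eq_zero_or_eq_zero h).elim hm hb0
  refine ⟨op (r * b), ?_, ?_⟩
  · rw [op_smul_eq_mul, ← mul_assoc]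
    exact B.mul_mem_left _ hb
  · rwa [op_smul_eq_mul, ← mul_assoc]

/-! ### Free modules inside direct sums of principal right ideals -/

/-- A non-zero element of a prime right Goldie ring has a right multiple by which left
multiplication is injective on a given uniform right ideal. -/
theorem IsRightGoldie.exists_mul_injOn (hA : IsRightGoldie A) (hp : IsPrimeRing A)
    {U : Submodule Aᵐᵒᵖ A} (hU : IsUniformSubmodule U) {b : A} (hb : b ≠ 0) :
    ∃ s, ∀ x ∈ U, b * s * x = 0 → x = 0 := by
  obtain ⟨u, hu, hu0⟩ := Submodule.exists_mem_ne_zero_of_ne_bot hU.1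
  obtain ⟨s, hs⟩ : ∃ s, b * s * u ≠ 0 := by
    by_contra! h
    exact (hp.eq_zero_or_eq_zero h).elim hb hu0
  refine ⟨s, fun x hx hx0 => by_contra fun hne => hs ?_⟩
  -- Now `U` meets `r(b s)`, which makes `r(b s u)` essential.
  have hmeet : U ⊓ rightAnnihilator A ({b * s} : Set A) ≠ ⊥ :=
    inf_ne_bot_of_mem hx (mem_rightAnnihilator_singleton_self.2 hx0) hne
  refine hA.eq_zero_of_isEssentialSubmodule_rightAnnihilator hp
    (.of_forall_exists_smul_mem fun m hm => ?_)
  by_cases hum : u * m = 0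
  · refine ⟨1, ?_, by simpa using hm⟩
    rw [one_smul, mem_rightAnnihilator_singleton_self, mul_assoc, hum, mul_zero]
  obtain ⟨t, ht, ht0⟩ := hU.exists_smul_mem hmeet (by simpa using U.smul_mem (op m) hu) hum
  rw [← op_unop t, op_smul_eq_mul] at ht ht0
  rw [mem_rightAnnihilator_singleton_self] at ht
  refine ⟨t, ?_, fun h => ht0 ?_⟩
  · rw [← op_unop t, op_smul_eq_mul, mem_rightAnnihilator_singleton_self, ← ht]
    noncomm_ring
  · rw [← op_unop t, op_smul_eq_mul] at h
    rw [mul_assoc, h, mul_zero]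

/-- There is an `n` such that any `n` non-zero principal right ideals contain elements with zero
common right annihilator. Here `n` is the number of uniform right ideals in an essential direct
sum `U₁ ⊕ ⋯ ⊕ Uₙ`; if `u₁ + ⋯ + uₙ` is a regular element of it and left multiplication by `bᵢ sᵢ`
is injective on `Uᵢ`, then the elements `bᵢ sᵢ uᵢ` are as required. -/
theorem IsRightGoldie.exists_forall_exists_mul_eq_zero [Nontrivial A] (hA : IsRightGoldie A)
    (hp : IsPrimeRing A) : ∃ n : ℕ, 0 < n ∧ ∀ b : Fin n → A, (∀ i, b i ≠ 0) →
      ∃ a : Fin n → A, ∀ x, (∀ i, b i * a i * x = 0) → x = 0 := by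
  obtain ⟨S, hS, hind, hess⟩ :=
    exists_sSupIndep_isUniformSubmodule fun N hN => hA.1.exists_isUniformSubmodule_le hN
  have hfin : Finite S := hA.1 S ⟨fun h => (hS _ h).1 rfl, hind⟩
  obtain ⟨c, hc, hreg⟩ := hA.exists_isRegular_mem hp hess
  have e := (Finite.equivFin S).symm
  have hsup : sSup S = ⨆ i ∈ (Finset.univ : Finset (Fin (Nat.card S))),
      (e i : Submodule Aᵐᵒᵖ A) := by
    rw [sSup_eq_iSup', ← e.iSup_comp]
    simp only [Finset.mem_univ, iSup_pos]
  rw [hsup, Submodule.mem_iSup_finset_iff_exists_sum] at hc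
  obtain ⟨u, hu⟩ := hc
  refine ⟨Nat.card S, ?_, fun b hb => ?_⟩
  · rw [Nat.pos_iff_ne_zero]
    intro h0
    have : IsEmpty (Fin (Nat.card S)) := by rw [h0]; infer_instance
    exact hreg.ne_zero (by rw [← hu, Finset.univ_eq_empty, Finset.sum_empty])
  · choose s hs using fun i => hA.exists_mul_injOn hp (hS _ (e i).2) (hb i)
    refine ⟨fun i => s i * u i, fun x hx => hreg.left ?_⟩
    have hux : ∀ i, (u i : A) * x = 0 := fun i =>
      hs i _ (by simpa using (e i : Submodule Aᵐᵒᵖ A).smul_mem (op x) (u i).2)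
        (by rw [← hx i]; noncomm_ring)
    simp only [mul_zero]
    rw [← hu, Finset.sum_mul]
    exact Finset.sum_eq_zero fun i _ => hux i

theorem exists_linearEquiv_submodule_directSum {n : ℕ} {b a : Fin n → A}
    (h : ∀ x, (∀ i, b i * a i * x = 0) → x = 0) :
    ∃ N : Submodule Aᵐᵒᵖ (DirectSum (Fin n) fun i => principalRightIdeal (b i)),
      Nonempty (A ≃ₗ[Aᵐᵒᵖ] N) := by
  have hmem : ∀ i x, orbitMap A (b i * a i) x ∈ principalRightIdeal (b i) := fun i x =>
    Submodule.mem_span_singleton.2 ⟨op (a i * x), by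
      rw [op_smul_eq_mul, orbitMap_apply_self, mul_assoc]⟩
  let f : A →ₗ[Aᵐᵒᵖ] DirectSum (Fin n) fun i => principalRightIdeal (b i) :=
    (DirectSum.linearEquivFunOnFintype Aᵐᵒᵖ (Fin n)
      fun i => principalRightIdeal (b i)).symm.toLinearMap ∘ₗ
        LinearMap.pi fun i => (orbitMap A (b i * a i)).codRestrict _ (hmem i)
  have hf : Function.Injective f := by
    rw [LinearMap.coe_comp]
    refine (LinearEquiv.injective _).comp ((injective_iff_map_eq_zero _).2 fun x hx => h x ?_)
    exact fun i => congrArg Subtype.val (congrFun hx i)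
  exact ⟨LinearMap.range f, ⟨LinearEquiv.ofInjective f hf⟩⟩

/-! ### Free submodules of non-singular modules -/

theorem IsNonsingularModule.exists_forall_mem_smul_eq_zero {M : Type*} [AddCommGroup M]
    [Module Aᵐᵒᵖ M] (hM : IsNonsingularModule A M) {x : M} (hx : x ≠ 0) :
    ∃ W : Submodule Aᵐᵒᵖ A, W ≠ ⊥ ∧ ∀ w ∈ W, op w • x = 0 → w = 0 := by
  have hns : x ∉ singularPart A M := by rw [hM]; exact hx
  simp only [singularPart, Set.mem_ofPred_eq, IsEssentialSubmodule, not_forall, not_not] at hns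
  obtain ⟨W, hW, hbot⟩ := hns
  exact ⟨W, hW, fun w hw hwx =>
    (Submodule.eq_bot_iff _).1 hbot w ⟨mem_rightAnnihilator_singleton.2 hwx, hw⟩⟩

theorem IsNonsingularModule.exists_isUniformSubmodule_le {M : Type*} [AddCommGroup M]
    [Module Aᵐᵒᵖ M] (hM : IsNonsingularModule A M) (hA : IsRightGoldie A)
    {N : Submodule Aᵐᵒᵖ M} (hN : N ≠ ⊥) : ∃ U ≤ N, IsUniformSubmodule U := by
  obtain ⟨x, hx, hx0⟩ := Submodule.exists_mem_ne_zero_of_ne_bot hN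
  obtain ⟨W, hW, hWx⟩ := hM.exists_forall_mem_smul_eq_zero hx0
  obtain ⟨U, hUW, hU⟩ := hA.1.exists_isUniformSubmodule_le hW
  refine ⟨U.map (orbitMap A x), ?_, hU.map _ fun w hw => hWx w (hUW hw)⟩
  rintro _ ⟨a, -, rfl⟩
  exact N.smul_mem _ hx

/-- A non-singular module of infinite Goldie dimension `τ` contains a linearly independent family
of cardinality `τ`. A maximal independent set of uniform submodules has cardinality `τ`; with `n` as
in `IsRightGoldie.exists_forall_exists_mul_eq_zero`, it is divided into `τ` blocks of `n`
submodules, and the sum of each block contains an element with zero annihilator. -/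
theorem IsNonsingularModule.exists_linearIndependent [Nontrivial A] {M : Type v} [AddCommGroup M]
    [Module Aᵐᵒᵖ M] (hM : IsNonsingularModule A M) (hA : IsRightGoldie A) (hp : IsPrimeRing A)
    (hinf : ℵ₀ ≤ goldieDim Aᵐᵒᵖ M) :
    ∃ (K : Type v) (f : K → M), #K = goldieDim Aᵐᵒᵖ M ∧ LinearIndependent Aᵐᵒᵖ f := by
  obtain ⟨S, hS, hind, hess⟩ :=
    exists_sSupIndep_isUniformSubmodule fun N hN => hM.exists_isUniformSubmodule_le hA hN
  rw [goldieDim_eq_mk hS hind hess] at hinf ⊢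
  obtain ⟨n, hn, hfree⟩ := hA.exists_forall_exists_mul_eq_zero hp
  -- Each `U` contains an element `y` whose annihilator is contained in `r(b)` for some `b ≠ 0`.
  have hy : ∀ U : S, ∃ y ∈ (U : Submodule Aᵐᵒᵖ M), ∃ b : A, b ≠ 0 ∧
      ∀ a : A, op a • y = 0 → b * a = 0 := by
    intro U
    obtain ⟨x, hx, hx0⟩ := Submodule.exists_mem_ne_zero_of_ne_bot (hS U U.2).1
    obtain ⟨W, hW, hWx⟩ := hM.exists_forall_mem_smul_eq_zero hx0
    obtain ⟨w, hw, hw0⟩ := Submodule.exists_mem_ne_zero_of_ne_bot hW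
    refine ⟨op w • x, U.1.smul_mem _ hx, w, hw0, fun a ha => hWx _ ?_ ?_⟩
    · simpa using W.smul_mem (op a) hw
    · rw [op_mul, mul_smul, ha]
  choose y hyU b hb0 hyb using hy
  obtain ⟨e⟩ : Nonempty (S × Fin n ≃ S) := by
    rw [← Cardinal.eq, Cardinal.mk_prod, Cardinal.lift_uzero, Cardinal.mk_fin, Cardinal.lift_natCast]
    exact Cardinal.mul_eq_left hinf ((Cardinal.natCast_lt_aleph0).le.trans hinf)
      (by exact_mod_cast hn.ne')
  choose a ha using fun k : S => hfree (fun i => b (e (k, i))) (fun i => hb0 _)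
  refine ⟨S, fun k => ∑ i, op (a k i) • y (e (k, i)), rfl, ?_⟩
  rw [linearIndependent_iff']
  intro s g hg k hk
  have hind' : iSupIndep fun p : S × Fin n => (e p : Submodule Aᵐᵒᵖ M) :=
    ((sSupIndep_iff S).1 hind).comp e.injective
  rw [iSupIndep_iff_finsetSum_eq_zero_imp_eq_zero] at hind'
  have hzero := hind' (s ×ˢ Finset.univ) (fun p => g p.1 • op (a p.1 p.2) • y (e p))
    (fun p _ => Submodule.smul_mem _ _ (Submodule.smul_mem _ _ (hyU _))) (by
      rw [Finset.sum_product, ← hg]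
      exact Finset.sum_congr rfl fun k _ => by rw [Finset.smul_sum])
  have hgk : (g k).unop = 0 := ha k _ fun i => by
    have h := hzero (k, i) (by simp [hk])
    rw [mul_assoc]
    refine hyb _ _ ?_
    rw [op_mul, op_unop, mul_smul]
    exact h
  rw [← op_unop (g k), hgk, op_zero]

end Goldie

theorem lemma2p4 (A : Type u) [Ring A] [Nontrivial A] (hprime : IsPrimeRing A)
    (hgoldie : IsRightGoldie A) :
    -- 1. non-zero ideals are essential right ideals and contain regular elements
    (∀ (B : Ideal A) [B.IsTwoSided], B ≠ ⊥ →
      IsEssentialSubmodule B.toRightIdeal ∧ ∃ b ∈ B, IsRegular b) ∧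
    -- 2. a uniform `n` such that `b₁A ⊕ ⋯ ⊕ bₙA` contains a copy of `A_A`
    (∃ n : ℕ, 0 < n ∧ ∀ b : Fin n → A, (∀ i, b i ≠ 0) →
      ∃ N : Submodule Aᵐᵒᵖ (DirectSum (Fin n) fun i => principalRightIdeal (b i)),
        Nonempty (A ≃ₗ[Aᵐᵒᵖ] N)) ∧
    -- 3. free submodules of rank `τ`
    (∀ (X : Type v) [AddCommGroup X] [Module Aᵐᵒᵖ X] (Y : Submodule Aᵐᵒᵖ X) (τ : Cardinal.{v}),
      IsNonsingularModule A Y → ℵ₀ ≤ τ → goldieDim Aᵐᵒᵖ Y = τ →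
      ∃ F : Submodule Aᵐᵒᵖ X, F ≠ ⊥ ∧
        (∃ ι : Type v, #ι = τ ∧ Nonempty (Module.Basis ι Aᵐᵒᵖ F)) ∧
        ∀ (N : Type w) [AddCommGroup N] [Module Aᵐᵒᵖ N], IsCardGenerated Aᵐᵒᵖ N τ →
          ∃ f : F →ₗ[Aᵐᵒᵖ] N, Function.Surjective f) ∧
    -- 4. seminoetherian modules
    (∀ τ : Cardinal.{v}, ℵ₀ ≤ τ →
      (∃ (M : Type v) (_ : AddCommGroup M) (_ : Module Aᵐᵒᵖ M),
        IsNonsingularModule A M ∧ IsSeminoetherian Aᵐᵒᵖ M ∧ goldieDim Aᵐᵒᵖ M = τ) →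
      (∀ (N : Type w) [AddCommGroup N] [Module Aᵐᵒᵖ N],
        IsCardGenerated Aᵐᵒᵖ N τ → IsSeminoetherian Aᵐᵒᵖ N) ∧
      (∀ (N : Type w) [AddCommGroup N] [Module Aᵐᵒᵖ N],
        IsCardGenerated Aᵐᵒᵖ N (ℵ₀ : Cardinal.{v}) → IsSeminoetherian Aᵐᵒᵖ N)) := by
  refine ⟨fun B _ hB => ?_, ?_, ?_, ?_⟩
  · have hess := hprime.isEssentialSubmodule_toRightIdeal B hB
    exact ⟨hess, hgoldie.exists_isRegular_mem hprime hess⟩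
  · obtain ⟨n, hn, hfree⟩ := hgoldie.exists_forall_exists_mul_eq_zero hprime
    refine ⟨n, hn, fun b hb => ?_⟩
    obtain ⟨a, ha⟩ := hfree b hb
    exact exists_linearEquiv_submodule_directSum ha
  · rintro X _ _ Y τ hY hτ rfl
    obtain ⟨K, f, hK, hf⟩ := hY.exists_linearIndependent hgoldie hprime hτ
    have hb := Module.Basis.span (hf.map' Y.subtype Y.ker_subtype)
    have : Nonempty K := by
      rw [← Cardinal.mk_ne_zero_iff, hK]
      exact (Cardinal.aleph0_pos.trans_le hτ).ne'
    refine ⟨_, fun h0 => hb.ne_zero (Classical.arbitrary K) ?_, ⟨K, hK, ⟨hb⟩⟩, fun N _ _ hN => ?_⟩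
    · exact Subtype.ext ((Submodule.eq_bot_iff _).1 h0 _ (hb _).2)
    · exact hb.exists_surjective_of_isCardGenerated (hK ▸ hN)
  · rintro τ hτ ⟨M, _, _, hM, hsemi, rfl⟩
    obtain ⟨K, f, hK, hf⟩ := hM.exists_linearIndependent hgoldie hprime hτ
    have main : ∀ (N : Type w) [AddCommGroup N] [Module Aᵐᵒᵖ N],
        IsCardGenerated Aᵐᵒᵖ N (goldieDim Aᵐᵒᵖ M) → IsSeminoetherian Aᵐᵒᵖ N := by
      intro N _ _ hN
      obtain ⟨g, hg⟩ := (Module.Basis.span hf).exists_surjective_of_isCardGenerated (hK ▸ hN)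
      exact hsemi.of_surjective _ g hg
    refine ⟨main, fun N _ _ ⟨s, hs, hspan⟩ => main N ⟨s, hs.trans ?_, hspan⟩⟩
    exact Cardinal.lift_le.2 hτ
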